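/- Let $N$ be a finite set with $|N|\ge 2$. A game over a finite non-empty set $A$ is a function $m:\mathcal P(A)\to\mathbb R$ with $m(\emptyset)=0$; it is balanced if there is $x\in\mathbb R^A$ with $\sum_{i\in A}x_i=m(A)$ and $\sum_{i\in S}x_i\ge m(S)$ for all $S\subseteq A$. A game over $N$ is totally balanced if its restriction to $\mathcal P(A)$ is balanced for every non-empty $A\subseteq N$. Let $T(N)$ be the (polyhedral) cone of all $m\in\mathbb R^{\mathcal P(N)}$ for which $S\mapsto m(S)-m(\emptyset)$ is a totally balanced game, and put $\langle\alpha,m\rangle=\sum_{S\subseteq N}\alpha(S)m(S)$. An inequality $\langle\alpha,m\rangle\ge k$ (with $\alpha\in\mathbb R^{\mathcal P(N)}$, $k\in\mathbb R$) is facet-defining for $T(N)$ if it holds for all $m\in T(N)$ and the set of $m\in T(N)$ that satisfy it with equality is a facet of $T(N)$, that is, is non-empty and of dimension $\dim T(N)-1$. Let $\chi_S\in\mathbb R^N$ denote the incidence vector of $S\subseteq N$. A non-empty set system $\mathcal B\subseteq\mathcal P(N)$ with carrier $M=\bigcup\mathcal B$ is min-balanced if it is inclusion-minimal among the set systems $\mathcal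 C\subseteq\mathcal P(N)$ such that $\chi_M$ (with this fixed $M$) lies in the conic hull of $\{\chi_S:S\in\mathcal C\}$; it is non-trivial if $|\mathcal B|\ge2$. A min-balanced system $\mathcal B$ is reducible if there are $A\subsetneq\bigcup\mathcal B$ and $B\in\mathcal B_A:=\{S\in\mathcal B: S\subsetneq A\}$ such that $\chi_A$ lies in the conic hull of $\{\chi_S:S\in\mathcal B_A\}$ and $\chi_{\bigcup\mathcal B}$ lies in the conic hull of $\{\chi_S:S\in\{A\}\cup(\mathcal B\setminus\{B\})\}$; otherwise it is irreducible. For a non-trivial min-balanced system $\mathcal B$ with carrier $M$ there are unique $\lambda_S>0$ ($S\in\mathcal B$) with $\chi_M=\sum_{S\in\mathcal B}\lambda_S\chi_S$, and there is a unique integer $k\ge1$ such that the numbers $k\lambda_S$ ($S\in\mathcal B$) are relatively prime integers. Define $\alpha_{\mathcal B}\in\mathbb R^{\mathcal P(N)}$ by $\alpha_{\mathcal B}(M)=k$, $\alpha_{\mathcal B}(S)=-k\lambda_S$ for $S\in\mathcal B$, $\alpha_{\mathcal B}(\emptyset)=-k+k\sum_{S\in\mathcal B}\lambda_S$, and $\alpha_{\mathcal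 B}(S)=0$ for all other $S\subseteq N$. **Theorem.** The facet-defining inequalities for $T(N)$ are, up to positive multiples, exactly the inequalities $\langle\alpha_{\mathcal B},m\rangle\ge0$ where $\mathcal B\subseteq\mathcal P(N)$ ranges over the non-trivial irreducible min-balanced systems. That is, $\langle\alpha,m\rangle\ge k$ is facet-defining for $T(N)$ if and only if $k=0$ and $\alpha=c\,\alpha_{\mathcal B}$ for some $c>0$ and some such $\mathcal B$. Moreover, $\mathcal B\mapsto\{m\in T(N):\langle\alpha_{\mathcal B},m\rangle=0\}$ is a bijection from the set of these systems onto the set of facets of $T(N)$. -/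

import Mathlib

open scoped BigOperators

noncomputable section

namespace TotallyBalanced

/-! Set functions on a finite player set `N` are maps `Finset N → ℝ`. -/

section Games

/-- A game is a set function that vanishes at the empty coalition. -/
def IsGame {N : Type*} (m : Finset N → ℝ) : Prop := m ∅ = 0

/-- The core: Pareto efficient and coalitionally rational payoff allocations. -/
def core {N : Type*} [Fintype N] (m : Finset N → ℝ) : Set (N → ℝ) :=
  {x | ∑ i, x i = m Finset.univ ∧ ∀ S : Finset N, m S ≤ ∑ i ∈ S, x i}

/-- A game is balanced if its core is non-empty. -/
def IsBalanced {N : Type*} [Fintype N] (m : Finset N → ℝ) : Prop :=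
  IsGame m ∧ (core m).Nonempty

/-- The restriction of a set function to the subsets of `A`, as a set function on the
player set `A`. -/
def subgame {N : Type*} (m : Finset N → ℝ) (A : Finset N) : Finset A → ℝ :=
  fun S => m (S.map (Function.Embedding.subtype fun i => i ∈ A))

/-- A game is totally balanced if each of its subgames (on a non-empty set of players) is
balanced. -/
def IsTotallyBalanced {N : Type*} (m : Finset N → ℝ) : Prop :=
  IsGame m ∧ ∀ A : Finset N, A.Nonempty → IsBalanced (subgame m A)

/-- The shifted set function `S ↦ m S - m ∅`. -/
def shift {N : Type*} (m : Finset N → ℝ) : Finset N → ℝ := fun S => m S - m ∅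

/-- The extended cone `T(N)` of totally balanced set functions. -/
def extendedCone (N : Type*) : Set (Finset N → ℝ) := {m | IsTotallyBalanced (shift m)}

end Games

section Facets

/-- The scalar product of two set functions. -/
def pairing {N : Type*} [Fintype N] (θ m : Finset N → ℝ) : ℝ := ∑ S, θ S * m S

/-- The points of `C` at which the inequality `⟨α, m⟩ ≥ k` holds with equality. -/
def face {N : Type*} [Fintype N] (C : Set (Finset N → ℝ)) (α : Finset N → ℝ) (k : ℝ) :
    Set (Finset N → ℝ) :=
  {m ∈ C | pairing α m = k}

/-- The dimension of (the affine hull of) a non-empty set. -/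
def affDim {N : Type*} (C : Set (Finset N → ℝ)) : ℕ := Module.finrank ℝ (vectorSpan ℝ C)

/-- The inequality `⟨α, m⟩ ≥ k` is facet-defining for `C`: it is valid on `C` and the points of
`C` at which it is tight form a non-empty set of dimension one less than that of `C`. -/
def IsFacetDefining {N : Type*} [Fintype N] (C : Set (Finset N → ℝ)) (α : Finset N → ℝ)
    (k : ℝ) : Prop :=
  (∀ m ∈ C, k ≤ pairing α m) ∧ (face C α k).Nonempty ∧ affDim (face C α k) + 1 = affDim C

/-- The facets of a (polyhedral) set `C`. -/
def facets {N : Type*} [Fintype N] (C : Set (Finset N → ℝ)) : Set (Set (Finset N → ℝ)) :=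
  {F | ∃ α k, IsFacetDefining C α k ∧ F = face C α k}

end Facets

section Systems

/-- The incidence vector of a coalition. -/
def incidence {N : Type*} [DecidableEq N] (S : Finset N) : N → ℝ := fun i => if i ∈ S then 1 else 0

/-- The carrier of a set system: the union of its members. -/
def carrier {N : Type*} [DecidableEq N] (B : Finset (Finset N)) : Finset N := B.biUnion id

/-- The conic hull of the incidence vectors of the members of a set system. -/
def incidenceCone {N : Type*} [DecidableEq N] (B : Finset (Finset N)) : PointedCone ℝ (N → ℝ) :=
  PointedCone.hull ℝ (incidence '' (B : Set (Finset N)))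

/-- A non-empty set system with carrier `M` is min-balanced if it is a minimal set system whose
incidence vectors have the incidence vector of (this fixed set) `M` in their conic hull. -/
def IsMinBalanced {N : Type*} [DecidableEq N] (B : Finset (Finset N)) : Prop :=
  B.Nonempty ∧ Minimal (fun C => incidence (carrier B) ∈ incidenceCone C) B

/-- Reducibility; both inclusions `A ⊂ carrier B` and `S ⊂ A` are strict. -/
def IsReducible {N : Type*} [DecidableEq N] (B : Finset (Finset N)) : Prop :=
  ∃ A, A ⊂ carrier B ∧ ∃ D ∈ B.filter (fun S => S ⊂ A),
    incidence A ∈ incidenceCone (B.filter fun S => S ⊂ A) ∧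
    incidence (carrier B) ∈ incidenceCone (insert A (B.erase D))

/-- The non-trivial irreducible min-balanced set systems of subsets of `N`. -/
def irreducibleSystems (N : Type*) [DecidableEq N] : Set (Finset (Finset N)) :=
  {B | IsMinBalanced B ∧ 2 ≤ B.card ∧ ¬ IsReducible B}

/-- `w` expresses the incidence vector of the carrier of `B` as a linear combination of those of
the members of `B` with strictly positive coefficients. -/
def IsBalancingWeights {N : Type*} [DecidableEq N] (B : Finset (Finset N))
    (w : Finset N → ℝ) : Prop :=
  (∀ S ∈ B, 0 < w S) ∧ (∀ S ∉ B, w S = 0) ∧ incidence (carrier B) = ∑ S ∈ B, w S • incidence S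

/-- The balancing weights; they exist and are unique if `B` is min-balanced. -/
def balancingWeights {N : Type*} [DecidableEq N] (B : Finset (Finset N)) : Finset N → ℝ :=
  Classical.epsilon (IsBalancingWeights B)

/-- `k ≥ 1`, and the numbers `k * w S`, for `S ∈ B`, are relatively prime integers, where `w`
denotes the balancing weights of `B`. -/
def IsNormalizer {N : Type*} [DecidableEq N] (B : Finset (Finset N)) (k : ℕ) : Prop :=
  1 ≤ k ∧ ∃ z : Finset N → ℤ,
    (∀ S ∈ B, (z S : ℝ) = k * balancingWeights B S) ∧ B.gcd z = 1

/-- The normalizing factor; it exists and is unique if `B` is min-balanced and non-trivial. -/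
def normalizer {N : Type*} [DecidableEq N] (B : Finset (Finset N)) : ℕ :=
  Classical.epsilon (IsNormalizer B)

/-- The coefficient vector assigned to a non-trivial min-balanced set system `B`. (Then the
carrier, the members of `B` and `∅` are pairwise distinct.) -/
def coefVector {N : Type*} [DecidableEq N] (B : Finset (Finset N)) : Finset N → ℝ := fun S =>
  if S = carrier B then (normalizer B : ℝ)
  else if S ∈ B then -(normalizer B * balancingWeights B S)
  else if S = ∅ then -(normalizer B : ℝ) + normalizer B * ∑ R ∈ B, balancingWeights B R
  else 0

end Systems

end TotallyBalanced

end

/-! By the Bondareva–Shapley theorem, `m` lies in the extended cone exactly when `excess A w m` is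
non-negative for all `A` and all conic weights `w` of `incidence A`. Weights whose support is not
min-balanced can be moved along a linear relation to a smaller support without increasing the
excess, so the non-trivial min-balanced systems already describe the cone, and there are finitely
many of them. The function `S ↦ |S|²` satisfies all these inequalities strictly, so the cone is
full-dimensional and its facets come from the irredundant inequalities. It remains to match
irredundancy with irreducibility.

If `incidence A` is a conic combination of members of `B` strictly inside `A`, trading those members
for `A` splits the inequality of `B` into a valid one plus a positive multiple of one for `A`. The
latter is not proportional to the inequality of `B`, so there is no facet
(`IsMinBalanced.not_isReducible`).

Conversely, suppose `coefVector B` is a conic combination of the other vectors, and let `C₀` have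
the smallest carrier among the systems used. No member of `C₀` is the carrier of a used system, so
the negative coefficients of `C₀` cannot cancel and `C₀ ⊆ B`. Equal carriers contradict the
minimality of `B`; a smaller carrier makes `B` reducible (`exists_separating_of_irreducible`). -/

set_option linter.unusedSectionVars false

namespace TotallyBalanced

/-! ### Farkas' lemma and a ratio test -/

/-- Farkas' lemma for finitely many linear functionals on a real vector space. -/
theorem exists_nonneg_combination_of_forall_nonneg {ι V : Type*} [AddCommGroup V] [Module ℝ V]
    (s : Finset ι) :
    ∀ (a : ι → V →ₗ[ℝ] ℝ) (b : V →ₗ[ℝ] ℝ), (∀ x, (∀ i ∈ s, 0 ≤ a i x) → 0 ≤ b x) →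
      ∃ c : ι → ℝ, (∀ i, 0 ≤ c i) ∧ ∀ x, b x = ∑ i ∈ s, c i * a i x := by
  classical
  induction s using Finset.induction_on with
  | empty =>
    intro a b h
    refine ⟨0, by simp, fun x => ?_⟩
    have h1 := h x (by simp)
    have h2 := h (-x) (by simp)
    simp only [map_neg] at h2
    simp only [Finset.sum_empty]
    linarith
  | insert j s hj ih =>
    intro a b h
    by_cases hs : ∀ x, (∀ i ∈ s, 0 ≤ a i x) → 0 ≤ b x
    · obtain ⟨c, hc, hb⟩ := ih a b hs
      refine ⟨fun i => if i = j then 0 else c i, fun i => ?_, fun x => ?_⟩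
      · dsimp only
        split_ifs <;> simp [hc]
      · rw [hb, Finset.sum_insert hj]
        simp only [if_true, zero_mul, zero_add]
        refine Finset.sum_congr rfl fun i hi => ?_
        rw [if_neg (by rintro rfl; exact hj hi)]
    · push Not at hs
      obtain ⟨y, hy, hby⟩ := hs
      have hjy : a j y < 0 := by
        by_contra hcon
        refine absurd (h y fun i hi => ?_) (not_le.2 hby)
        rcases Finset.mem_insert.1 hi with rfl | hi
        · exact not_lt.1 hcon
        · exact hy i hi
      -- Each functional is precomposed with the projection along `y` onto the kernel of `a j`; this
      -- removes the constraint `j`.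
      obtain ⟨c, hc, hb⟩ := ih (fun i => a i - (a i y / a j y) • a j) (b - (b y / a j y) • a j) (by
        intro x hx
        have key : ∀ f : V →ₗ[ℝ] ℝ,
            (f - (f y / a j y) • a j) x = f (x - (a j x / a j y) • y) := fun f => by
          simp only [LinearMap.sub_apply, LinearMap.smul_apply, smul_eq_mul, map_sub, map_smul]
          ring
        rw [key]
        refine h _ fun i hi => ?_
        rcases Finset.mem_insert.1 hi with rfl | hi
        · simp [div_mul_cancel₀ _ hjy.ne]
        · rw [← key]
          exact hx i hi)
      have hr : 0 ≤ b y / a j y - ∑ i ∈ s, c i * (a i y / a j y) := by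
        have h1 : 0 ≤ b y / a j y := (div_pos_of_neg_of_neg hby hjy).le
        have h2 : ∑ i ∈ s, c i * (a i y / a j y) ≤ 0 := Finset.sum_nonpos fun i hi =>
          mul_nonpos_of_nonneg_of_nonpos (hc i) (div_nonpos_of_nonneg_of_nonpos (hy i hi) hjy.le)
        linarith
      refine ⟨fun i => if i = j then b y / a j y - ∑ i ∈ s, c i * (a i y / a j y) else c i,
        fun i => ?_, fun x => ?_⟩
      · dsimp only
        split_ifs
        · exact hr
        · exact hc i
      · rw [Finset.sum_insert hj]
        simp only [if_true]
        have h1 : ∑ i ∈ s, (if i = j then b y / a j y - ∑ i ∈ s, c i * (a i y / a j y) else c i) *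
            a i x = ∑ i ∈ s, c i * a i x := by
          refine Finset.sum_congr rfl fun i hi => ?_
          rw [if_neg (by rintro rfl; exact hj hi)]
        have h2 := hb x
        simp only [LinearMap.sub_apply, LinearMap.smul_apply, smul_eq_mul, mul_sub,
          Finset.sum_sub_distrib] at h2
        rw [h1, sub_mul, Finset.sum_mul]
        simp only [mul_assoc] at h2 ⊢
        linarith

/-- A positive vector can be moved against any direction that has a positive entry until an entry
vanishes, without leaving the non-negative orthant. -/
theorem exists_step_to_boundary {ι : Type*} (C : Finset ι) (w d : ι → ℝ)
    (hw : ∀ S ∈ C, 0 < w S) (hd : ∃ S ∈ C, 0 < d S) :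
    ∃ t : ℝ, 0 < t ∧ ∃ D ∈ C, 0 < d D ∧ w D = t * d D ∧ ∀ S ∈ C, t * d S ≤ w S := by
  classical
  obtain ⟨S₀, hS₀, hd₀⟩ := hd
  obtain ⟨D, hD, hmin⟩ := (C.filter fun S => 0 < d S).exists_min_image (fun S => w S / d S)
    ⟨S₀, Finset.mem_filter.2 ⟨hS₀, hd₀⟩⟩
  obtain ⟨hDC, hdD⟩ := Finset.mem_filter.1 hD
  have ht : 0 < w D / d D := div_pos (hw D hDC) hdD
  refine ⟨w D / d D, ht, D, hDC, hdD, (div_mul_cancel₀ _ hdD.ne').symm, fun S hS => ?_⟩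
  by_cases hdS : 0 < d S
  · exact (le_div_iff₀ hdS).1 (hmin S (Finset.mem_filter.2 ⟨hS, hdS⟩))
  · exact (mul_nonpos_of_nonneg_of_nonpos ht.le (not_lt.1 hdS)).trans (hw S hS).le

/-! ### Conic combinations of incidence vectors -/

theorem incidence_of_mem {N : Type*} [DecidableEq N] {S : Finset N} {i : N} (h : i ∈ S) : incidence S i = 1 := if_pos h

theorem incidence_of_notMem {N : Type*} [DecidableEq N] {S : Finset N} {i : N} (h : i ∉ S) : incidence S i = 0 := if_neg h

theorem incidence_nonneg {N : Type*} [DecidableEq N] (S : Finset N) (i : N) : 0 ≤ incidence S i := by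
  unfold incidence; split_ifs <;> norm_num

section Weights

variable {N : Type*} [Fintype N] [DecidableEq N]

/-- `w` expresses `v` as a conic combination of the incidence vectors of the members of `C`. -/
structure IsConicWeights (C : Finset (Finset N)) (v : N → ℝ) (w : Finset N → ℝ) : Prop where
  nonneg : ∀ S, 0 ≤ w S
  eq_zero : ∀ S ∉ C, w S = 0
  sum_eq : ∑ S, w S • incidence S = v

theorem sum_smul_eq_of_support {C : Finset (Finset N)} {w : Finset N → ℝ}
    (h : ∀ S ∉ C, w S = 0) :
    ∑ S, w S • incidence S = ∑ S ∈ C, w S • incidence S :=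
  (Finset.sum_subset (Finset.subset_univ C) fun S _ hS => by rw [h S hS, zero_smul]).symm

theorem mem_incidenceCone_iff {C : Finset (Finset N)} {v : N → ℝ} :
    v ∈ incidenceCone C ↔ ∃ w, IsConicWeights C v w := by
  rw [incidenceCone, PointedCone.hull, Submodule.mem_span_image_finset_iff_exists_fun']
  constructor
  · rintro ⟨c, hc⟩
    refine ⟨fun S => if S ∈ C then (c S : ℝ) else 0, fun S => ?_, fun S hS => if_neg hS, ?_⟩
    · split_ifs
      · exact (c S).2
      · exact le_rfl
    · rw [sum_smul_eq_of_support (C := C) fun S hS => if_neg hS, ← hc]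
      exact Finset.sum_congr rfl fun S hS => by rw [if_pos hS]; rfl
  · rintro ⟨w, h0, hC, hw⟩
    refine ⟨fun S => ⟨w S, h0 S⟩, ?_⟩
    rw [← hw, sum_smul_eq_of_support hC]
    rfl

theorem IsConicWeights.mono {C C' : Finset (Finset N)} {v : N → ℝ} {w : Finset N → ℝ}
    (h : IsConicWeights C v w) (hC : C ⊆ C') : IsConicWeights C' v w :=
  ⟨h.nonneg, fun S hS => h.eq_zero S fun h' => hS (hC h'), h.sum_eq⟩

theorem IsConicWeights.erase {C : Finset (Finset N)} {v : N → ℝ} {w : Finset N → ℝ}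
    (h : IsConicWeights C v w) {D : Finset N} (hD : w D = 0) :
    IsConicWeights (C.erase D) v w :=
  ⟨h.nonneg, fun S hS => by
    by_cases hSD : S = D
    · rw [hSD, hD]
    · exact h.eq_zero S fun hSC => hS (Finset.mem_erase.2 ⟨hSD, hSC⟩), h.sum_eq⟩

/-- Moving along a linear relation, see `exists_step_to_boundary`. -/
theorem IsConicWeights.sub_mul_relation {C : Finset (Finset N)} {v : N → ℝ} {w d : Finset N → ℝ} {t : ℝ}
    (h : IsConicWeights C v w) (hd : ∀ S ∉ C, d S = 0) (hd0 : ∑ S, d S • incidence S = 0)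
    (ht : ∀ S ∈ C, t * d S ≤ w S) : IsConicWeights C v (fun S => w S - t * d S) := by
  refine ⟨fun S => ?_, fun S hS => by rw [h.eq_zero S hS, hd S hS]; simp, ?_⟩
  · by_cases hS : S ∈ C
    · exact sub_nonneg.2 (ht S hS)
    · rw [h.eq_zero S hS, hd S hS]; simp
  · simp only [sub_smul, mul_smul, Finset.sum_sub_distrib, ← Finset.smul_sum, hd0, smul_zero,
      sub_zero, h.sum_eq]

theorem sum_incidence_mul (S : Finset N) (y : N → ℝ) :
    ∑ i, incidence S i * y i = ∑ i ∈ S, y i := by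
  simp [incidence, Finset.sum_ite_mem]

/-- Pairing a conic representation with an allocation `y` and exchanging the sums is how weights are
tested against core elements and against `|S|²`. -/
theorem sum_mul_sum_eq {w : Finset N → ℝ} {v : N → ℝ} (h : ∑ S, w S • incidence S = v)
    (y : N → ℝ) : ∑ S, w S * ∑ i ∈ S, y i = ∑ i, v i * y i := by
  subst h
  simp only [Finset.sum_apply, Pi.smul_apply, smul_eq_mul, Finset.sum_mul]
  rw [Finset.sum_comm]
  refine Finset.sum_congr rfl fun S _ => ?_
  simp only [mul_assoc, ← Finset.mul_sum, sum_incidence_mul]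

theorem sum_incidence_apply {w : Finset N → ℝ} {v : N → ℝ} (h : ∑ S, w S • incidence S = v)
    (i : N) : ∑ S, w S * incidence S i = v i := by
  rw [← h]; simp [Finset.sum_apply]

/-- At a player outside `A`, non-negative terms add up to zero, so no set containing that player
carries weight. -/
theorem IsConicWeights.subset_of_pos {C : Finset (Finset N)} {A S : Finset N} {w : Finset N → ℝ}
    (h : IsConicWeights C (incidence A) w) (hS : 0 < w S) : S ⊆ A := by
  intro i hi
  by_contra hiA
  have h1 := sum_incidence_apply h.sum_eq i
  rw [incidence_of_notMem hiA, Finset.sum_eq_zero_iff_of_nonneg fun S _ =>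
    mul_nonneg (h.nonneg S) (incidence_nonneg S i)] at h1
  have h2 := h1 S (Finset.mem_univ S)
  rw [incidence_of_mem hi, mul_one] at h2
  exact hS.ne' h2

theorem IsConicWeights.exists_pos {C : Finset (Finset N)} {A : Finset N} {w : Finset N → ℝ}
    (h : IsConicWeights C (incidence A) w) {i : N} (hi : i ∈ A) :
    ∃ S ∈ C, i ∈ S ∧ 0 < w S := by
  by_contra hcon
  push Not at hcon
  have h1 := sum_incidence_apply h.sum_eq i
  rw [incidence_of_mem hi, Finset.sum_eq_zero] at h1
  · exact zero_ne_one h1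
  · intro S _
    by_cases hS : S ∈ C
    · by_cases hiS : i ∈ S
      · rw [le_antisymm (hcon S hS hiS) (h.nonneg S), zero_mul]
      · rw [incidence_of_notMem hiS, mul_zero]
    · rw [h.eq_zero S hS, zero_mul]

theorem IsConicWeights.carrier_eq {C : Finset (Finset N)} {A : Finset N} {w : Finset N → ℝ}
    (h : IsConicWeights C (incidence A) w) (hpos : ∀ S ∈ C, 0 < w S) : carrier C = A := by
  ext i
  simp only [carrier, Finset.mem_biUnion, id]
  constructor
  · rintro ⟨S, hS, hi⟩
    exact h.subset_of_pos (hpos S hS) hi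
  · intro hi
    obtain ⟨S, hS, hiS, -⟩ := h.exists_pos hi
    exact ⟨S, hS, hiS⟩

end Weights

/-! ### Min-balanced systems and their weights -/

theorem IsMinBalanced.not_mem_cone_of_ssubset {N : Type*} [DecidableEq N] {B C : Finset (Finset N)} (hB : IsMinBalanced B)
    (hC : C ⊂ B) : incidence (carrier B) ∉ incidenceCone C := fun h =>
  hC.2 (hB.2.2 h hC.1)

theorem subset_carrier {N : Type*} [DecidableEq N] {B : Finset (Finset N)} {S : Finset N} (h : S ∈ B) : S ⊆ carrier B :=
  fun _ hi => Finset.mem_biUnion.2 ⟨S, h, hi⟩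

section MinBalanced

variable {N : Type*} [Fintype N] [DecidableEq N]

theorem IsMinBalanced.pos {B : Finset (Finset N)} (hB : IsMinBalanced B) {w : Finset N → ℝ}
    (hw : IsConicWeights B (incidence (carrier B)) w) : ∀ S ∈ B, 0 < w S := by
  intro D hD
  refine lt_of_le_of_ne (hw.nonneg D) fun h0 => ?_
  exact hB.not_mem_cone_of_ssubset (Finset.erase_ssubset hD)
    (mem_incidenceCone_iff.2 ⟨w, hw.erase h0.symm⟩)

theorem IsMinBalanced.exists_conicWeights {B : Finset (Finset N)} (hB : IsMinBalanced B) :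
    ∃ w, IsConicWeights B (incidence (carrier B)) w :=
  mem_incidenceCone_iff.1 hB.2.1

theorem IsMinBalanced.isBalancingWeights {B : Finset (Finset N)} (hB : IsMinBalanced B) :
    IsBalancingWeights B (balancingWeights B) := by
  obtain ⟨w, hw⟩ := hB.exists_conicWeights
  refine Classical.epsilon_spec (p := IsBalancingWeights B) ⟨w, hB.pos hw, hw.eq_zero, ?_⟩
  rw [← sum_smul_eq_of_support hw.eq_zero, hw.sum_eq]

theorem IsMinBalanced.conic {B : Finset (Finset N)} (hB : IsMinBalanced B) :
    IsConicWeights B (incidence (carrier B)) (balancingWeights B) := by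
  obtain ⟨h1, h2, h3⟩ := hB.isBalancingWeights
  refine ⟨fun S => ?_, h2, by rw [sum_smul_eq_of_support h2, h3]⟩
  by_cases hS : S ∈ B
  · exact (h1 S hS).le
  · exact (h2 S hS).ge

/-- The incidence vectors of the members of a min-balanced system are linearly independent. -/
theorem IsMinBalanced.eq_zero_of_relation {B : Finset (Finset N)} (hB : IsMinBalanced B)
    {d : Finset N → ℝ} (hd : ∀ S ∉ B, d S = 0) (hd0 : ∑ S, d S • incidence S = 0) : d = 0 := by
  have key : ∀ d : Finset N → ℝ, (∀ S ∉ B, d S = 0) → ∑ S, d S • incidence S = 0 →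
      ∀ S ∈ B, d S ≤ 0 := by
    intro d hd hd0
    by_contra hcon
    push Not at hcon
    -- A positive entry of `d` would allow a move to conic weights that vanish at a member `D`,
    -- although minimality forces all of them to be positive.
    obtain ⟨t, -, D, hD, -, hwD, ht⟩ := exists_step_to_boundary B (balancingWeights B) d
      hB.isBalancingWeights.1 hcon
    have h := hB.conic.sub_mul_relation hd hd0 ht
    exact (sub_pos.1 (hB.pos h D hD)).ne' hwD
  funext S
  by_cases hS : S ∈ B
  · refine le_antisymm (key d hd hd0 S hS) ?_
    have := key (-d) (fun S hS => by simp [hd S hS]) (by simp [hd0]) S hS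
    simpa using this
  · exact hd S hS

/-- Uniqueness, from linear independence; it identifies any weights at hand with the chosen
`balancingWeights`. -/
theorem IsMinBalanced.eq_balancingWeights {B : Finset (Finset N)} (hB : IsMinBalanced B)
    {w : Finset N → ℝ} (hw : ∀ S ∉ B, w S = 0)
    (hs : ∑ S, w S • incidence S = incidence (carrier B)) : w = balancingWeights B := by
  have := hB.eq_zero_of_relation (d := w - balancingWeights B)
    (fun S hS => by simp [hw S hS, hB.conic.eq_zero S hS])
    (by simp [_root_.sub_smul, hs, hB.conic.sum_eq])
  exact sub_eq_zero.1 this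

theorem IsMinBalanced.carrier_notMem {B : Finset (Finset N)} (hB : IsMinBalanced B)
    (h2 : 2 ≤ B.card) : carrier B ∉ B := by
  intro h
  refine hB.not_mem_cone_of_ssubset (C := {carrier B}) ?_ ?_
  · refine Finset.ssubset_iff_subset_ne.2 ⟨Finset.singleton_subset_iff.2 h, fun he => ?_⟩
    rw [← he] at h2
    simp at h2
  · exact Submodule.subset_span (by simp)

theorem IsMinBalanced.empty_notMem {B : Finset (Finset N)} (hB : IsMinBalanced B) : ∅ ∉ B := by
  intro h
  -- The incidence vector of `∅` is zero, so `∅` alone would be a linear relation.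
  have := hB.eq_zero_of_relation (d := Pi.single ∅ 1)
    (fun S hS => Pi.single_eq_of_ne (by rintro rfl; exact hS h) 1) (by
      funext i
      simp only [Finset.sum_apply, Pi.smul_apply, smul_eq_mul, Pi.zero_apply]
      refine Finset.sum_eq_zero fun S _ => ?_
      by_cases hS : S = ∅
      · subst hS; rw [incidence_of_notMem (Finset.notMem_empty i), mul_zero]
      · rw [Pi.single_eq_of_ne hS, zero_mul])
  exact one_ne_zero (α := ℝ) (by simpa using congrFun this (∅ : Finset N))

theorem IsMinBalanced.ssubset_carrier {B : Finset (Finset N)} (hB : IsMinBalanced B)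
    (h2 : 2 ≤ B.card) {S : Finset N} (h : S ∈ B) : S ⊂ carrier B :=
  Finset.ssubset_iff_subset_ne.2
    ⟨subset_carrier h, fun he => hB.carrier_notMem h2 (he ▸ h)⟩

theorem IsMinBalanced.carrier_nonempty {B : Finset (Finset N)} (hB : IsMinBalanced B) :
    (carrier B).Nonempty := by
  obtain ⟨S, hS⟩ := hB.1
  have : S.Nonempty := Finset.nonempty_iff_ne_empty.2 fun h => hB.empty_notMem (h ▸ hS)
  exact this.mono (subset_carrier hS)

/-- The condition on `A` in the definition of reducibility is implied by the one on the members
strictly inside `A`. -/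
theorem IsMinBalanced.exists_exchange {B : Finset (Finset N)} (hB : IsMinBalanced B)
    {A : Finset N} (hA0 : A.Nonempty) {μ : Finset N → ℝ}
    (hμ : IsConicWeights (B.filter fun S => S ⊂ A) (incidence A) μ) :
    ∃ t : ℝ, 0 < t ∧ ∃ D ∈ B.filter (fun S => S ⊂ A),
      IsConicWeights (insert A (B.erase D)) (incidence (carrier B))
        (fun S => balancingWeights B S - t * μ S + if S = A then t else 0) := by
  obtain ⟨i, hi⟩ := hA0
  obtain ⟨S, hS, -, hSμ⟩ := hμ.exists_pos hi
  obtain ⟨t, ht, D, hD, hdD, hwD, hle⟩ := exists_step_to_boundary B (balancingWeights B) μ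
    hB.isBalancingWeights.1 ⟨S, (Finset.mem_filter.1 hS).1, hSμ⟩
  have hμB : ∀ S ∉ B, μ S = 0 := fun S hS => hμ.eq_zero S fun h => hS (Finset.mem_filter.1 h).1
  have hDf : D ∈ B.filter fun S => S ⊂ A := by
    by_contra h
    exact hdD.ne' (hμ.eq_zero D h)
  refine ⟨t, ht, D, hDf, fun S => ?_, fun S hS => ?_, ?_⟩
  · have h1 : 0 ≤ balancingWeights B S - t * μ S := by
      by_cases hS : S ∈ B
      · exact sub_nonneg.2 (hle S hS)
      · rw [hB.conic.eq_zero S hS, hμB S hS]; simp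
    have h2 : (0 : ℝ) ≤ if S = A then t else 0 := by split_ifs; exacts [ht.le, le_rfl]
    exact add_nonneg h1 h2
  · simp only [Finset.mem_insert, Finset.mem_erase, not_or, not_and] at hS
    rw [if_neg hS.1, add_zero]
    by_cases hSD : S = D
    · rw [hSD, hwD, sub_self]
    · rw [hB.conic.eq_zero S (hS.2 hSD), hμB S (hS.2 hSD)]; simp
  · simp only [add_smul, _root_.sub_smul, mul_smul, Finset.sum_add_distrib,
      Finset.sum_sub_distrib, ← Finset.smul_sum, hB.conic.sum_eq, hμ.sum_eq, ite_smul, zero_smul,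
      Finset.sum_ite_eq', Finset.mem_univ, if_true]
    abel

theorem IsMinBalanced.isReducible {B : Finset (Finset N)} (hB : IsMinBalanced B)
    {A : Finset N} (hA : A ⊂ carrier B) (hA0 : A.Nonempty)
    (h : incidence A ∈ incidenceCone (B.filter fun S => S ⊂ A)) : IsReducible B := by
  obtain ⟨μ, hμ⟩ := mem_incidenceCone_iff.1 h
  obtain ⟨t, -, D, hD, hw⟩ := hB.exists_exchange hA0 hμ
  exact ⟨A, hA, D, hD, h, mem_incidenceCone_iff.2 ⟨_, hw⟩⟩

/-! ### Rationality and the normalizing factor -/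

/-- Balancing weights are rational: apply a `ℚ`-linear retraction of `ℝ` onto `ℚ` to them. -/
theorem IsMinBalanced.exists_rat_weights {B : Finset (Finset N)} (hB : IsMinBalanced B) :
    ∃ q : Finset N → ℚ, ∀ S, (q S : ℝ) = balancingWeights B S := by
  obtain ⟨f, hf⟩ := (Algebra.linearMap ℚ ℝ).exists_leftInverse_of_injective
    (LinearMap.ker_eq_bot.2 (algebraMap ℚ ℝ).injective)
  have hf1 : ∀ q : ℚ, f (q : ℝ) = q := fun q => by
    simpa using LinearMap.congr_fun hf q
  refine ⟨fun S => f (balancingWeights B S), fun S => ?_⟩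
  -- Incidence entries are 0 or 1, so `f` sends balancing weights to balancing weights; uniqueness
  -- makes them fixed.
  refine congrFun (hB.eq_balancingWeights (w := fun S => (f (balancingWeights B S) : ℝ)) ?_ ?_) S
  · intro S hS
    simp [hB.conic.eq_zero S hS]
  · have hinc : ∀ (S : Finset N) (i : N), ∀ x : ℝ, f (x * incidence S i) =
        f x * (if i ∈ S then 1 else 0) := by
      intro S i x
      unfold incidence
      split_ifs <;> simp
    funext i
    have h := congrArg f (sum_incidence_apply hB.conic.sum_eq i)
    have h' : f (incidence (carrier B) i) = if i ∈ carrier B then 1 else 0 := by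
      have := hinc (carrier B) i 1
      have h1 := hf1 1
      rw [Rat.cast_one] at h1
      rwa [one_mul, h1, one_mul] at this
    rw [map_sum, h'] at h
    simp only [hinc] at h
    have h2 := congrArg (fun q : ℚ => (q : ℝ)) h
    simp only [Finset.sum_apply, Pi.smul_apply, smul_eq_mul]
    simpa only [Rat.cast_sum, Rat.cast_mul, apply_ite (Rat.cast : ℚ → ℝ), Rat.cast_one,
      Rat.cast_zero, incidence] using h2

/-- Clear denominators with `D`, then divide `D` and the integers `D * λ_S` by the gcd of the
latter. -/
theorem IsMinBalanced.exists_isNormalizer {B : Finset (Finset N)} (hB : IsMinBalanced B) :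
    ∃ k, IsNormalizer B k := by
  obtain ⟨q, hq⟩ := hB.exists_rat_weights
  set D : ℕ := ∏ S ∈ B, (q S).den with hD
  have hD0 : 0 < D := Finset.prod_pos fun S _ => (q S).den_pos
  have hz : ∀ S, ∃ z : ℤ, S ∈ B → (z : ℝ) = D * balancingWeights B S := by
    intro S
    by_cases hS : S ∈ B
    · obtain ⟨e, he⟩ : (q S).den ∣ D := Finset.dvd_prod_of_mem _ hS
      refine ⟨e * (q S).num, fun _ => ?_⟩
      rw [← hq S, he]
      have : ((q S).den : ℝ) * (q S : ℝ) = (q S).num := by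
        exact_mod_cast Rat.den_mul_eq_num (q S)
      push_cast
      rw [← this]; ring
    · exact ⟨0, fun h => absurd h hS⟩
  choose z hz using hz
  obtain ⟨i, hi⟩ := hB.carrier_nonempty
  -- The balancing identity at a player `i` of the carrier shows that the gcd of the `z S` divides
  -- `D`, so the quotient `k` is an integer.
  have hsum : (D : ℤ) = ∑ S ∈ B, z S * (if i ∈ S then 1 else 0) := by
    have h := sum_incidence_apply hB.conic.sum_eq i
    rw [incidence_of_mem hi, ← Finset.sum_subset (Finset.subset_univ B)
      fun S _ hS => by rw [hB.conic.eq_zero S hS, zero_mul]] at h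
    have h' : (D : ℝ) = ∑ S ∈ B, (z S : ℝ) * incidence S i := by
      rw [Finset.sum_congr rfl fun S hS => by rw [hz S hS, mul_assoc], ← Finset.mul_sum, h,
        mul_one]
    have : ((D : ℤ) : ℝ) = ((∑ S ∈ B, z S * (if i ∈ S then 1 else 0) : ℤ) : ℝ) := by
      push_cast
      exact h'
    exact_mod_cast this
  obtain ⟨g, hg, hg1⟩ := Finset.extract_gcd z hB.1
  have hgD : B.gcd z ∣ (D : ℤ) := by
    rw [hsum]
    exact Finset.dvd_sum fun S hS => (Finset.gcd_dvd hS).mul_right _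
  obtain ⟨k, hk⟩ := hgD
  have hDz : (0 : ℤ) < D := by exact_mod_cast hD0
  have hg0 : 0 < B.gcd z := by
    refine lt_of_le_of_ne ?_ ?_
    · rw [← Finset.normalize_gcd]
      exact Int.nonneg_of_normalize_eq_self (normalize_idem _)
    · intro h; rw [← h, zero_mul] at hk; exact hDz.ne' hk
  have hk0 : 0 < k := by
    rw [hk] at hDz
    exact (pos_iff_pos_of_mul_pos hDz).1 hg0
  refine ⟨k.toNat, by omega, g, fun S hS => ?_, hg1⟩
  have h1 := hz S hS
  rw [hg S hS] at h1
  have hkr : ((k.toNat : ℕ) : ℝ) = (k : ℝ) := by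
    exact_mod_cast congrArg (Int.cast : ℤ → ℝ) (Int.toNat_of_nonneg hk0.le)
  have h2 : (D : ℝ) = (B.gcd z : ℤ) * (k : ℝ) := by exact_mod_cast congrArg (Int.cast : ℤ → ℝ) hk
  rw [hkr]
  rw [h2, mul_assoc] at h1
  push_cast at h1
  exact mul_left_cancel₀ (by exact_mod_cast hg0.ne') h1

theorem IsMinBalanced.normalizer_pos {B : Finset (Finset N)} (hB : IsMinBalanced B) :
    (0 : ℝ) < normalizer B := by
  have h : IsNormalizer B (normalizer B) := Classical.epsilon_spec hB.exists_isNormalizer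
  exact_mod_cast h.1

end MinBalanced

/-! ### Balancedness inequalities and the Bondareva–Shapley theorem -/

section Inequalities

variable {N : Type*} [Fintype N] [DecidableEq N]

/-- The amount by which the set function `m`, shifted to a game, satisfies the balancedness
inequality for `A` and the weights `w`. -/
def excess (A : Finset N) (w m : Finset N → ℝ) : ℝ := shift m A - ∑ S, w S * shift m S

/-- The coefficient vector of `excess A w`. -/
def excessVector (A : Finset N) (w : Finset N → ℝ) : Finset N → ℝ := fun S =>
  -- The extra term at `∅` collects the copies of `m ∅` subtracted by `shift`.
  (if S = A then 1 else 0) - w S + if S = ∅ then ∑ R, w R - 1 else 0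

theorem pairing_excessVector (A : Finset N) (w m : Finset N → ℝ) :
    pairing (excessVector A w) m = excess A w m := by
  simp only [pairing, excessVector, excess, shift, add_mul, sub_mul, mul_sub, ite_mul, one_mul,
    zero_mul, Finset.sum_add_distrib, Finset.sum_sub_distrib, Finset.sum_ite_eq', Finset.mem_univ,
    if_true, ← Finset.sum_mul]
  ring

theorem shift_empty (m : Finset N → ℝ) : shift m ∅ = 0 := sub_self _

/-- The case distinction becomes an additive formula because the carrier, the members of `B` and `∅`
are pairwise distinct. -/
theorem IsMinBalanced.coefVector_eq {B : Finset (Finset N)} (hB : IsMinBalanced B)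
    (h2 : 2 ≤ B.card) :
    coefVector B = (normalizer B : ℝ) • excessVector (carrier B) (balancingWeights B) := by
  have hM := hB.carrier_notMem h2
  have hM0 := hB.carrier_nonempty.ne_empty
  have hsum : ∑ R, balancingWeights B R = ∑ R ∈ B, balancingWeights B R :=
    (Finset.sum_subset (Finset.subset_univ B) fun S _ hS => hB.conic.eq_zero S hS).symm
  funext S
  simp only [coefVector, excessVector, Pi.smul_apply, smul_eq_mul, hsum]
  by_cases h1 : S = carrier B
  · rw [if_pos h1, if_pos h1, if_neg (h1 ▸ hM0), hB.conic.eq_zero S (h1 ▸ hM)]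
    ring
  · by_cases hS : S ∈ B
    · rw [if_neg h1, if_neg h1, if_pos hS,
        if_neg (by rintro rfl; exact hB.empty_notMem hS)]
      ring
    · rw [if_neg h1, if_neg h1, if_neg hS, hB.conic.eq_zero S hS]
      split_ifs <;> ring

theorem pairing_smul (c : ℝ) (θ m : Finset N → ℝ) : pairing (c • θ) m = c * pairing θ m := by
  simp [pairing, Finset.mul_sum, mul_assoc]

theorem pairing_coefVector {B : Finset (Finset N)} (hB : IsMinBalanced B) (h2 : 2 ≤ B.card)
    (m : Finset N → ℝ) :
    pairing (coefVector B) m = normalizer B * excess (carrier B) (balancingWeights B) m := by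
  rw [hB.coefVector_eq h2, pairing_smul, pairing_excessVector]

/-- If the game `m` restricted to the subsets of `A` has `y` as a core element, all balancedness
inequalities for `A` hold. -/
theorem excess_nonneg_of_core {A : Finset N} {C : Finset (Finset N)} {w m : Finset N → ℝ}
    (hw : IsConicWeights C (incidence A) w) (y : N → ℝ) (hA : ∑ i ∈ A, y i = shift m A)
    (hS : ∀ S ⊆ A, shift m S ≤ ∑ i ∈ S, y i) : 0 ≤ excess A w m := by
  have h := sum_mul_sum_eq hw.sum_eq y
  rw [sum_incidence_mul, hA] at h
  rw [excess, sub_nonneg, ← h]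
  refine Finset.sum_le_sum fun S _ => ?_
  rcases (hw.nonneg S).lt_or_eq with h0 | h0
  · exact mul_le_mul_of_nonneg_left (hS S (hw.subset_of_pos h0)) h0.le
  · rw [← h0, zero_mul, zero_mul]

theorem sum_map_subtype (A : Finset N) (S : Finset A) (y : N → ℝ) :
    ∑ i ∈ S.map (Function.Embedding.subtype fun i => i ∈ A), y i = ∑ i ∈ S, y i := by
  rw [Finset.sum_map]; rfl

theorem exists_map_subtype_eq {A S : Finset N} (h : S ⊆ A) :
    ∃ S' : Finset A, S'.map (Function.Embedding.subtype fun i => i ∈ A) = S := by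
  refine ⟨S.subtype fun i => i ∈ A, ?_⟩
  exact Finset.subtype_map_of_mem h

/-- The easy half of Bondareva–Shapley: a core element of the subgame on `A`, extended by zero,
bounds the weighted sum. Total balancedness says nothing about empty `A`, which is treated apart. -/
theorem excess_nonneg {m : Finset N → ℝ} (hm : m ∈ extendedCone N) {A : Finset N}
    {C : Finset (Finset N)} {w : Finset N → ℝ} (hw : IsConicWeights C (incidence A) w) :
    0 ≤ excess A w m := by
  rcases A.eq_empty_or_nonempty with rfl | hA
  · exact excess_nonneg_of_core hw 0 (by simp [shift_empty]) fun S hS => by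
      rw [Finset.subset_empty.1 hS, shift_empty]; simp
  · obtain ⟨-, x, hxA, hxS⟩ := hm.2 A hA
    set y : N → ℝ := fun i => if h : i ∈ A then x ⟨i, h⟩ else 0 with hy
    have hyx : ∀ S : Finset A, ∑ i ∈ S.map (Function.Embedding.subtype fun i => i ∈ A), y i =
        ∑ i ∈ S, x i := fun S => by
      rw [sum_map_subtype]
      exact Finset.sum_congr rfl fun i _ => by simp [hy]
    have huniv : (Finset.univ : Finset A).map (Function.Embedding.subtype fun i => i ∈ A) = A := by
      ext i; simp
    refine excess_nonneg_of_core hw y ?_ fun S hS => ?_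
    · have h := hyx Finset.univ
      rw [huniv] at h
      rw [h, hxA, subgame, huniv]
    · obtain ⟨S', rfl⟩ := exists_map_subtype_eq hS
      rw [hyx]
      exact hxS S'

/-- The Bondareva–Shapley theorem, via Farkas' lemma. -/
theorem mem_extendedCone_of_excess_nonneg {m : Finset N → ℝ}
    (h : ∀ (A : Finset N) (C : Finset (Finset N)) (w : Finset N → ℝ), A.Nonempty → ∅ ∉ C →
      IsConicWeights C (incidence A) w → 0 ≤ excess A w m) : m ∈ extendedCone N := by
  refine ⟨shift_empty m, fun A hA => ⟨by simp [IsGame, subgame, shift_empty], ?_⟩⟩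
  -- Homogenization: a pair `(x, t)` with `t > 0` satisfying the constraints yields the core element
  -- `x / t`.
  let σ : Finset N → ((N → ℝ) × ℝ) →ₗ[ℝ] ℝ := fun S =>
    (∑ i ∈ S, LinearMap.proj i) ∘ₗ LinearMap.fst ℝ (N → ℝ) ℝ -
      shift m S • LinearMap.snd ℝ (N → ℝ) ℝ
  have hσ : ∀ S x, σ S x = ∑ i ∈ S, x.1 i - shift m S * x.2 := fun S x => by
    simp [σ]
  -- The index `none` stands for the efficiency bound `x(A) ≤ t * shift m A`. The coalition `∅` is
  -- left out of the constraints below so that the weights obtained avoid it.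
  let a : Option (Finset N) → ((N → ℝ) × ℝ) →ₗ[ℝ] ℝ := fun o => o.elim (-σ A) σ
  obtain ⟨x, hx, hx2⟩ : ∃ x : (N → ℝ) × ℝ,
      (∀ o ∈ Finset.insertNone (A.powerset.erase ∅), 0 ≤ a o x) ∧ 0 < x.2 := by
    by_contra hcon
    push Not at hcon
    obtain ⟨c, hc, hsum⟩ := exists_nonneg_combination_of_forall_nonneg
      (Finset.insertNone (A.powerset.erase ∅)) a (-LinearMap.snd ℝ (N → ℝ) ℝ)
      (fun x hx => by simpa using hcon x hx)
    set w : Finset N → ℝ := fun S => if S ∈ A.powerset.erase ∅ then c (some S) else 0 with hw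
    have hw0 : ∀ S, 0 ≤ w S := fun S => by
      simp only [hw]; split_ifs
      · exact hc _
      · exact le_rfl
    have hkey : ∀ x : (N → ℝ) × ℝ, -x.2 = c none * -(∑ i ∈ A, x.1 i - shift m A * x.2) +
        ∑ S, w S * (∑ i ∈ S, x.1 i - shift m S * x.2) := by
      intro x
      have h1 := hsum x
      rw [Finset.sum_insertNone] at h1
      simp only [a, Option.elim, LinearMap.neg_apply, hσ, LinearMap.snd_apply] at h1
      rw [h1]
      simp only [hw, ite_mul, zero_mul, Finset.sum_ite_mem, Finset.univ_inter]
    -- Evaluation at `(e_i, 0)` gives the balancing identity; evaluation at `(0, 1)` then gives the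
    -- value of the weighted sum.
    have hrep : ∑ S, w S • incidence S = c none • incidence A := by
      funext i
      have h1 := hkey (Pi.single i 1, 0)
      have h2 : ∀ S : Finset N, ∑ j ∈ S, (Pi.single i 1 : N → ℝ) j = incidence S i := fun S => by
        simp [incidence]
      simp only [h2, mul_zero, sub_zero, neg_zero] at h1
      simp only [Finset.sum_apply, Pi.smul_apply, smul_eq_mul]
      linarith
    have hval : ∑ S, w S * shift m S = 1 + c none * shift m A := by
      have h1 := hkey (0, 1)
      simp only [Pi.zero_apply, Finset.sum_const_zero, mul_one, zero_sub, mul_neg, neg_neg,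
        Finset.sum_neg_distrib] at h1
      linarith
    -- If `c none > 0`, the rescaled weights have excess `-(c none)⁻¹ < 0`. If `c none = 0`, no
    -- non-empty set has weight and the weighted sum is 0 instead of 1.
    rcases (hc none).lt_or_eq with h0 | h0
    · have hcw : IsConicWeights (A.powerset.erase ∅) (incidence A)
          (fun S => (c none)⁻¹ * w S) := by
        refine ⟨fun S => mul_nonneg (inv_nonneg.2 h0.le) (hw0 S), fun S hS => ?_, ?_⟩
        · simp only [hw]; rw [if_neg hS, mul_zero]
        · simp only [mul_smul, ← Finset.smul_sum, hrep]
          rw [smul_smul, inv_mul_cancel₀ h0.ne', one_smul]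
      have h1 := h A _ _ hA (Finset.notMem_erase _ _) hcw
      simp only [excess, mul_assoc, ← Finset.mul_sum, hval] at h1
      rw [mul_add, mul_one, inv_mul_cancel_left₀ h0.ne'] at h1
      have := inv_pos.2 h0
      linarith
    · rw [← h0, zero_smul] at hrep
      rw [← h0, zero_mul, add_zero] at hval
      have hzero : ∀ S, w S * shift m S = 0 := by
        intro S
        rcases S.eq_empty_or_nonempty with rfl | ⟨i, hi⟩
        · rw [shift_empty, mul_zero]
        · have h1 := sum_incidence_apply hrep i
          rw [Pi.zero_apply, Finset.sum_eq_zero_iff_of_nonneg fun S _ =>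
            mul_nonneg (hw0 S) (incidence_nonneg S i)] at h1
          have h2 := h1 S (Finset.mem_univ S)
          rw [incidence_of_mem hi, mul_one] at h2
          rw [h2, zero_mul]
      rw [Finset.sum_eq_zero fun S _ => hzero S] at hval
      exact zero_ne_one hval
  have hxS : ∀ S ⊆ A, shift m S ≤ ∑ i ∈ S, x.1 i / x.2 := by
    intro S hS
    rw [← Finset.sum_div, le_div_iff₀ hx2]
    rcases S.eq_empty_or_nonempty with rfl | hS0
    · simp [shift_empty]
    · have h1 := hx (some S) (by
        rw [Finset.some_mem_insertNone]
        exact Finset.mem_erase.2 ⟨hS0.ne_empty, Finset.mem_powerset.2 hS⟩)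
      simp only [a, Option.elim, hσ] at h1
      linarith
  have hxA : ∑ i ∈ A, x.1 i / x.2 ≤ shift m A := by
    rw [← Finset.sum_div, div_le_iff₀ hx2]
    have h1 := hx none (Finset.none_mem_insertNone)
    simp only [a, Option.elim, LinearMap.neg_apply, hσ] at h1
    linarith
  refine ⟨fun i => x.1 i / x.2, ?_, fun S => ?_⟩
  · have huniv : (Finset.univ : Finset A).map (Function.Embedding.subtype fun i => i ∈ A) = A := by
      ext i; simp
    have h1 := sum_map_subtype A Finset.univ (fun i => x.1 i / x.2)
    rw [huniv] at h1
    rw [← h1, subgame, huniv]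
    exact le_antisymm hxA (hxS A subset_rfl)
  · rw [← sum_map_subtype A S (fun i => x.1 i / x.2)]
    refine hxS _ fun i hi => ?_
    obtain ⟨j, -, rfl⟩ := Finset.mem_map.1 hi
    exact j.2

theorem excess_sub_smul (A : Finset N) (w d m : Finset N → ℝ) (t : ℝ) :
    excess A (fun S => w S - t * d S) m = excess A w m + t * ∑ S, d S * shift m S := by
  simp only [excess, sub_mul, Finset.sum_sub_distrib, mul_assoc, ← Finset.mul_sum]
  ring

/-- It suffices to consider the weights of non-trivial min-balanced systems. -/
theorem excess_nonneg_of_minBalanced {m : Finset N → ℝ}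
    (hm : ∀ B : Finset (Finset N), IsMinBalanced B → 2 ≤ B.card → 0 ≤ pairing (coefVector B) m)
    {A : Finset N} (hA : A.Nonempty) (C : Finset (Finset N)) :
    ∀ w : Finset N → ℝ, ∅ ∉ C → IsConicWeights C (incidence A) w → 0 ≤ excess A w m := by
  induction C using Finset.strongInduction with
  | H C ih =>
  intro w hC hw
  by_cases hpos : ∀ S ∈ C, 0 < w S
  · have hcar := hw.carrier_eq hpos
    obtain ⟨i, hi⟩ := hA
    obtain ⟨S₀, hS₀, -, -⟩ := hw.exists_pos hi
    by_cases hmin : IsMinBalanced C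
    · have hbw : w = balancingWeights C :=
        hmin.eq_balancingWeights hw.eq_zero (by rw [hcar]; exact hw.sum_eq)
      by_cases h2 : 2 ≤ C.card
      · have h := hm C hmin h2
        rw [pairing_coefVector hmin h2, hcar, ← hbw] at h
        exact nonneg_of_mul_nonneg_right h hmin.normalizer_pos
      · obtain rfl : C = {S₀} := by
          symm
          refine Finset.eq_of_subset_of_card_le (Finset.singleton_subset_iff.2 hS₀) ?_
          rw [Finset.card_singleton]; omega
        obtain rfl : S₀ = A := by simpa [carrier] using hcar
        have h1 := sum_incidence_apply hw.sum_eq i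
        rw [Finset.sum_eq_single S₀ (fun S _ hS => by
            rw [hw.eq_zero S (by simpa using hS), zero_mul]) (by simp),
          incidence_of_mem hi, mul_one] at h1
        rw [excess, Finset.sum_eq_single S₀ (fun S _ hS => by
          rw [hw.eq_zero S (by simpa using hS), zero_mul]) (by simp), h1, one_mul, sub_self]
    · have hex : ∃ C' ⊂ C, incidence A ∈ incidenceCone C' := by
        by_contra hcon
        push Not at hcon
        refine hmin ⟨⟨S₀, hS₀⟩, ?_, fun C' hC' hle => ?_⟩
        · rw [hcar]; exact mem_incidenceCone_iff.2 ⟨w, hw⟩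
        · by_contra hn
          rw [hcar] at hC'
          exact hcon C' ⟨hle, hn⟩ hC'
      obtain ⟨C', hC', hcone⟩ := hex
      obtain ⟨v, hv⟩ := mem_incidenceCone_iff.1 hcone
      obtain ⟨S₁, hS₁, hS₁'⟩ := Finset.exists_of_ssubset hC'
      -- The weights `v` live on a proper subsystem, so `w - v` is a relation on `C`, positive at
      -- `S₁`.
      have hd : ∀ S ∉ C, w S - v S = 0 := fun S hS => by
        rw [hw.eq_zero S hS, hv.eq_zero S fun h => hS (hC'.1 h), sub_zero]
      have hd0 : ∑ S, (w S - v S) • incidence S = 0 := by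
        simp only [_root_.sub_smul, Finset.sum_sub_distrib, hw.sum_eq, hv.sum_eq, sub_self]
      have hp : ∃ S ∈ C, 0 < w S - v S := ⟨S₁, hS₁, by
        rw [hv.eq_zero S₁ hS₁', sub_zero]; exact hpos S₁ hS₁⟩
      -- Otherwise `w - v` is a non-negative relation with positive weight on the non-empty set
      -- `S₁`; this is where `∅ ∉ C` is needed.
      have hn : ∃ S ∈ C, 0 < v S - w S := by
        by_contra hcon
        push Not at hcon
        obtain ⟨j, hj⟩ : S₁.Nonempty := Finset.nonempty_iff_ne_empty.2 fun h => hC (h ▸ hS₁)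
        have h1 := sum_incidence_apply hd0 j
        rw [Pi.zero_apply, Finset.sum_eq_zero_iff_of_nonneg fun S _ => mul_nonneg (by
          by_cases hS : S ∈ C
          · linarith [hcon S hS]
          · exact (hd S hS).ge) (incidence_nonneg S j)] at h1
        have h2 := h1 S₁ (Finset.mem_univ S₁)
        rw [incidence_of_mem hj, mul_one, hv.eq_zero S₁ hS₁', sub_zero] at h2
        exact (hpos S₁ hS₁).ne' h2
      have step : ∀ d : Finset N → ℝ, (∀ S ∉ C, d S = 0) → ∑ S, d S • incidence S = 0 →
          (∃ S ∈ C, 0 < d S) → ∑ S, d S * shift m S ≤ 0 → 0 ≤ excess A w m := by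
        intro d hd hd0 hp hle
        obtain ⟨t, ht, D, hD, -, hwD, ht'⟩ := exists_step_to_boundary C w d hpos hp
        have h1 := (hw.sub_mul_relation hd hd0 ht').erase (D := D) (sub_eq_zero.2 hwD)
        have h2 := ih _ (Finset.erase_ssubset hD) _ (fun h => hC (Finset.mem_of_mem_erase h)) h1
        rw [excess_sub_smul] at h2
        have := mul_nonpos_of_nonneg_of_nonpos ht.le hle
        linarith
      -- The excess is affine along the relation, so the sign is chosen for which it does not
      -- increase on the way to the smaller support.
      rcases le_total (∑ S, (w S - v S) * shift m S) 0 with hle | hle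
      · exact step (fun S => w S - v S) hd hd0 hp hle
      · refine step (fun S => v S - w S) (fun S hS => by linarith [hd S hS]) ?_ hn ?_
        · simp only [_root_.sub_smul, Finset.sum_sub_distrib, hw.sum_eq, hv.sum_eq, sub_self]
        · simp only [sub_mul, Finset.sum_sub_distrib] at hle ⊢
          linarith
  · push Not at hpos
    obtain ⟨D, hD, hwD⟩ := hpos
    exact ih _ (Finset.erase_ssubset hD) w (fun h => hC (Finset.mem_of_mem_erase h))
      (hw.erase (le_antisymm hwD (hw.nonneg D)))

/-- The finitely many linear inequalities that describe the extended cone. -/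
theorem mem_extendedCone_iff {m : Finset N → ℝ} : m ∈ extendedCone N ↔
    ∀ B : Finset (Finset N), IsMinBalanced B → 2 ≤ B.card → 0 ≤ pairing (coefVector B) m := by
  refine ⟨fun hm B hB h2 => ?_, fun h => mem_extendedCone_of_excess_nonneg
    fun A C w hA hC hw => excess_nonneg_of_minBalanced h hA C w hC hw⟩
  rw [pairing_coefVector hB h2]
  exact mul_nonneg hB.normalizer_pos.le (excess_nonneg hm hB.conic)

/-- The squared cardinality satisfies all the inequalities strictly. -/
theorem IsMinBalanced.pairing_card_sq_pos {B : Finset (Finset N)} (hB : IsMinBalanced B)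
    (h2 : 2 ≤ B.card) : 0 < pairing (coefVector B) fun S => (S.card : ℝ) ^ 2 := by
  rw [pairing_coefVector hB h2]
  refine mul_pos hB.normalizer_pos ?_
  -- For the constant allocation `|M|`, with `M` the carrier, the weighted sum of `|S| |M|` is
  -- `|M|²`; the claim follows from `|S| < |M|` on `B`.
  have h := sum_mul_sum_eq hB.conic.sum_eq fun _ => (carrier B).card
  rw [sum_incidence_mul] at h
  simp only [Finset.sum_const, nsmul_eq_mul] at h
  simp only [excess, shift, Finset.card_empty, Nat.cast_zero, ne_eq, OfNat.ofNat_ne_zero,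
    not_false_eq_true, zero_pow, sub_zero, sub_pos]
  rw [sq, ← h]
  obtain ⟨S, hS⟩ := hB.1
  have hlt : ∀ S ∈ B, (S.card : ℝ) < (carrier B).card := fun S hS => by
    exact_mod_cast Finset.card_lt_card (hB.ssubset_carrier h2 hS)
  refine Finset.sum_lt_sum (fun S _ => ?_) ⟨S, Finset.mem_univ S, ?_⟩
  · by_cases hS : S ∈ B
    · refine mul_le_mul_of_nonneg_left ?_ (hB.conic.nonneg S)
      rw [sq]
      exact mul_le_mul_of_nonneg_left (hlt S hS).le (Nat.cast_nonneg _)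
    · rw [hB.conic.eq_zero S hS, zero_mul, zero_mul]
  · refine mul_lt_mul_of_pos_left ?_ (hB.isBalancingWeights.1 S hS)
    rw [sq]
    refine mul_lt_mul_of_pos_left (hlt S hS) ?_
    have : S.Nonempty := Finset.nonempty_iff_ne_empty.2 fun h => hB.empty_notMem (h ▸ hS)
    exact_mod_cast this.card_pos

end Inequalities

/-! ### Faces and facets of the extended cone -/

section FacetLemmas

variable {N : Type*} [Fintype N] [DecidableEq N]

/-- The linear functional given by the scalar product with `θ`. -/
def pairingHom (θ : Finset N → ℝ) : (Finset N → ℝ) →ₗ[ℝ] ℝ where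
  toFun := pairing θ
  map_add' x y := by simp [pairing, mul_add, Finset.sum_add_distrib]
  map_smul' c x := by simp [pairing, Finset.mul_sum, mul_left_comm]

theorem pairingHom_apply (θ m : Finset N → ℝ) : pairingHom θ m = pairing θ m := rfl

theorem pairing_single (θ : Finset N → ℝ) (S : Finset N) : pairing θ (Pi.single S 1) = θ S := by
  simp [pairing, Pi.single_apply]

theorem pairing_zero_right (θ : Finset N → ℝ) : pairing θ 0 = 0 := (pairingHom θ).map_zero

theorem pairing_zero_left (m : Finset N → ℝ) : pairing 0 m = 0 := by simp [pairing]

theorem pairing_smul_right (θ m : Finset N → ℝ) (c : ℝ) :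
    pairing θ (c • m) = c * pairing θ m := (pairingHom θ).map_smul c m

theorem pairing_add_right (θ m m' : Finset N → ℝ) :
    pairing θ (m + m') = pairing θ m + pairing θ m' := (pairingHom θ).map_add m m'

theorem pairingHom_ne_zero {θ : Finset N → ℝ} (h : θ ≠ 0) : pairingHom θ ≠ 0 := by
  intro h0
  refine h (funext fun S => ?_)
  rw [← pairing_single θ S, ← pairingHom_apply, h0]
  rfl

theorem finrank_ker_pairingHom {θ : Finset N → ℝ} (h : θ ≠ 0) :
    Module.finrank ℝ (pairingHom θ).ker + 1 = Module.finrank ℝ (Finset N → ℝ) :=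
  Module.Dual.finrank_ker_add_one_of_ne_zero (pairingHom_ne_zero h)

theorem exists_eq_smul_of_ker_le {α β : Finset N → ℝ}
    (h : (pairingHom α).ker ≤ (pairingHom β).ker) : ∃ c : ℝ, β = c • α := by
  have h1 := mem_span_of_iInf_ker_le_ker (L := fun _ : Unit => pairingHom α)
    (K := pairingHom β) (by simpa using h)
  rw [Set.range_const, Submodule.mem_span_singleton] at h1
  obtain ⟨c, hc⟩ := h1
  refine ⟨c, funext fun S => ?_⟩
  rw [← pairing_single β S, ← pairingHom_apply, ← hc, LinearMap.smul_apply, pairingHom_apply,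
    pairing_single]
  rfl

/-- Strict inequalities survive small perturbations. -/
theorem exists_perturbation {κ : Type*} (s : Finset κ) (θ : κ → Finset N → ℝ)
    {q : Finset N → ℝ} (hq : ∀ B ∈ s, 0 < pairing (θ B) q) (v : Finset N → ℝ) :
    ∃ ε : ℝ, 0 < ε ∧ ∀ B ∈ s, 0 < pairing (θ B) (q + ε • v) := by
  have h : ∀ᶠ ε : ℝ in nhdsWithin 0 (Set.Ioi 0), ∀ B ∈ s, 0 < pairing (θ B) (q + ε • v) := by
    rw [Filter.eventually_all_finset]
    intro B hB
    have hcont : Continuous fun ε : ℝ => pairing (θ B) (q + ε • v) := by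
      simp only [pairing_add_right, pairing_smul_right]
      fun_prop
    refine (hcont.tendsto 0).mono_left nhdsWithin_le_nhds |>.eventually_const_lt ?_
    simpa using hq B hB
  obtain ⟨ε, hε, hpos⟩ := (h.and self_mem_nhdsWithin).exists
  exact ⟨ε, hpos, hε⟩

theorem mem_vectorSpan_of_add_smul {F : Set (Finset N → ℝ)} {q v : Finset N → ℝ} {ε : ℝ}
    (hε : 0 < ε) (hq : q ∈ F) (hqv : q + ε • v ∈ F) : v ∈ vectorSpan ℝ F := by
  have h := Submodule.smul_mem _ ε⁻¹ (vsub_mem_vectorSpan ℝ hqv hq)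
  rwa [vsub_eq_sub, add_sub_cancel_left, smul_smul, inv_mul_cancel₀ hε.ne', one_smul] at h

variable (N) in
open Classical in
/-- The non-trivial min-balanced set systems. -/
noncomputable def minBalancedSystems : Finset (Finset (Finset N)) :=
  Finset.univ.filter fun B => IsMinBalanced B ∧ 2 ≤ B.card

theorem mem_minBalancedSystems {B : Finset (Finset N)} :
    B ∈ minBalancedSystems N ↔ IsMinBalanced B ∧ 2 ≤ B.card := by
  simp [minBalancedSystems]

theorem mem_extendedCone_iff_forall_mem {m : Finset N → ℝ} :
    m ∈ extendedCone N ↔ ∀ B ∈ minBalancedSystems N, 0 ≤ pairing (coefVector B) m := by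
  simp only [mem_extendedCone_iff, mem_minBalancedSystems, and_imp]

theorem card_sq_mem_extendedCone : (fun S : Finset N => (S.card : ℝ) ^ 2) ∈ extendedCone N :=
  mem_extendedCone_iff.2 fun _ hB h2 => (hB.pairing_card_sq_pos h2).le

theorem zero_mem_extendedCone : (0 : Finset N → ℝ) ∈ extendedCone N :=
  mem_extendedCone_iff.2 fun _ _ _ => (pairing_zero_right _).ge

theorem smul_mem_extendedCone {m : Finset N → ℝ} (hm : m ∈ extendedCone N) {c : ℝ} (hc : 0 ≤ c) :
    c • m ∈ extendedCone N :=
  mem_extendedCone_iff.2 fun B hB h2 => by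
    rw [pairing_smul_right]
    exact mul_nonneg hc (mem_extendedCone_iff.1 hm B hB h2)

/-- The squared cardinality is an interior point, so a small step in any direction stays in the
cone. -/
theorem vectorSpan_extendedCone : vectorSpan ℝ (extendedCone N) = ⊤ := by
  refine eq_top_iff.2 fun v _ => ?_
  obtain ⟨ε, hε, h⟩ := exists_perturbation (minBalancedSystems N) coefVector
    (fun B hB => (mem_minBalancedSystems.1 hB).1.pairing_card_sq_pos
      (mem_minBalancedSystems.1 hB).2) v
  exact mem_vectorSpan_of_add_smul hε card_sq_mem_extendedCone
    (mem_extendedCone_iff_forall_mem.2 fun B hB => (h B hB).le)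

theorem affDim_extendedCone :
    affDim (extendedCone N) = Module.finrank ℝ (Finset N → ℝ) := by
  rw [affDim, vectorSpan_extendedCone, finrank_top]

theorem zero_mem_face (α : Finset N → ℝ) : (0 : Finset N → ℝ) ∈ face (extendedCone N) α 0 :=
  ⟨zero_mem_extendedCone, pairing_zero_right α⟩

theorem vectorSpan_face_le (C : Set (Finset N → ℝ)) (α : Finset N → ℝ) (k : ℝ) :
    vectorSpan ℝ (face C α k) ≤ (pairingHom α).ker := by
  rw [vectorSpan, Submodule.span_le]
  rintro _ ⟨x, hx, y, hy, rfl⟩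
  change pairingHom α (x - y) = 0
  rw [map_sub, pairingHom_apply, pairingHom_apply, hx.2, hy.2, sub_self]

theorem isFacetDefining_of_ker_le {α : Finset N → ℝ} (h0 : α ≠ 0)
    (hval : ∀ m ∈ extendedCone N, 0 ≤ pairing α m)
    (h : (pairingHom α).ker ≤ vectorSpan ℝ (face (extendedCone N) α 0)) :
    IsFacetDefining (extendedCone N) α 0 := by
  refine ⟨hval, ⟨0, zero_mem_face α⟩, ?_⟩
  rw [affDim_extendedCone, affDim, le_antisymm (vectorSpan_face_le _ _ _) h,
    finrank_ker_pairingHom h0]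

/-- The cone contains 0, whence `k ≤ 0`, and the double of a point where the inequality is tight,
whence `k ≤ 2 * k`. -/
theorem IsFacetDefining.eq_zero {α : Finset N → ℝ} {k : ℝ}
    (h : IsFacetDefining (extendedCone N) α k) : k = 0 := by
  obtain ⟨hval, ⟨m, hm, hk⟩, -⟩ := h
  have h1 := hval 0 zero_mem_extendedCone
  have h2 := hval _ (smul_mem_extendedCone hm (c := 2) (by norm_num))
  rw [pairing_zero_right] at h1
  rw [pairing_smul_right, hk] at h2
  linarith

theorem IsFacetDefining.ne_zero {α : Finset N → ℝ}
    (h : IsFacetDefining (extendedCone N) α 0) : α ≠ 0 := by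
  rintro rfl
  have hF : face (extendedCone N) 0 0 = extendedCone N :=
    Set.ext fun m => ⟨fun h => h.1, fun h => ⟨h, pairing_zero_left m⟩⟩
  have := h.2.2
  rw [hF] at this
  omega

theorem IsFacetDefining.vectorSpan_eq {α : Finset N → ℝ}
    (h : IsFacetDefining (extendedCone N) α 0) :
    vectorSpan ℝ (face (extendedCone N) α 0) = (pairingHom α).ker := by
  refine Submodule.eq_of_le_of_finrank_eq (vectorSpan_face_le _ _ _) ?_
  have h1 := h.2.2
  have h2 := finrank_ker_pairingHom h.ne_zero
  rw [affDim_extendedCone] at h1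
  unfold affDim at h1
  omega

/-- A facet determines the functionals that vanish on it up to multiples. -/
theorem IsFacetDefining.exists_eq_smul {α β : Finset N → ℝ}
    (h : IsFacetDefining (extendedCone N) α 0)
    (hβ : ∀ m ∈ face (extendedCone N) α 0, pairing β m = 0) : ∃ c : ℝ, β = c • α := by
  refine exists_eq_smul_of_ker_le ?_
  rw [← h.vectorSpan_eq, vectorSpan, Submodule.span_le]
  rintro _ ⟨x, hx, y, hy, rfl⟩
  change pairingHom β (x - y) = 0
  rw [map_sub, pairingHom_apply, pairingHom_apply, hβ x hx, hβ y hy, sub_self]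

theorem face_smul {c : ℝ} (hc : 0 < c) (C : Set (Finset N → ℝ)) (α : Finset N → ℝ) :
    face C (c • α) 0 = face C α 0 := by
  ext m
  simp only [face, Set.mem_ofPred_eq, pairing_smul, mul_eq_zero, hc.ne', false_or]

theorem IsFacetDefining.smul {C : Set (Finset N → ℝ)} {α : Finset N → ℝ}
    (h : IsFacetDefining C α 0) {c : ℝ} (hc : 0 < c) : IsFacetDefining C (c • α) 0 := by
  refine ⟨fun m hm => ?_, ?_, ?_⟩
  · rw [pairing_smul]; exact mul_nonneg hc.le (h.1 m hm)
  · rw [face_smul hc]; exact h.2.1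
  · rw [face_smul hc]; exact h.2.2

/-! ### Irreducibility and irredundancy -/

theorem coefVector_carrier (B : Finset (Finset N)) :
    coefVector B (carrier B) = normalizer B := if_pos rfl

/-- The sign pattern off `∅` recovers `B`; both the separation argument and injectivity rest on
this. -/
theorem IsMinBalanced.coefVector_neg_iff {B : Finset (Finset N)} (hB : IsMinBalanced B)
    (h2 : 2 ≤ B.card) {S : Finset N} (hS : S ≠ ∅) : coefVector B S < 0 ↔ S ∈ B := by
  unfold coefVector
  by_cases h1 : S = carrier B
  · rw [if_pos h1, h1]
    exact ⟨fun h => absurd h hB.normalizer_pos.le.not_gt,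
      fun h => absurd h (hB.carrier_notMem h2)⟩
  · rw [if_neg h1]
    by_cases hSB : S ∈ B
    · rw [if_pos hSB]
      simp only [hSB, iff_true, neg_neg_iff_pos]
      exact mul_pos hB.normalizer_pos (hB.isBalancingWeights.1 S hSB)
    · rw [if_neg hSB, if_neg hS]
      simp [hSB]

theorem coefVector_nonpos_of_ne {B : Finset (Finset N)} (hB : IsMinBalanced B)
    {S : Finset N} (hS : S ≠ ∅) (h1 : S ≠ carrier B) : coefVector B S ≤ 0 := by
  unfold coefVector
  rw [if_neg h1]
  split_ifs with hSB
  · simp only [Left.neg_nonpos_iff]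
    exact mul_nonneg hB.normalizer_pos.le (hB.conic.nonneg S)
  · exact le_rfl

theorem IsMinBalanced.coefVector_ne_zero {B : Finset (Finset N)} (hB : IsMinBalanced B) :
    coefVector B ≠ 0 := fun h => hB.normalizer_pos.ne' (by
  rw [← coefVector_carrier, h]; rfl)

/-- The coefficient vector of an irreducible system is not a conic combination of the others. -/
theorem exists_separating_of_irreducible {B : Finset (Finset N)}
    (hB : B ∈ irreducibleSystems N) :
    ∃ m, (∀ C ∈ (minBalancedSystems N).erase B, 0 ≤ pairing (coefVector C) m) ∧
      pairing (coefVector B) m < 0 := by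
  obtain ⟨hmin, h2, hirr⟩ := hB
  by_contra hcon
  push Not at hcon
  obtain ⟨c, hc, hsum⟩ := exists_nonneg_combination_of_forall_nonneg
    ((minBalancedSystems N).erase B) (fun C => pairingHom (coefVector C))
    (pairingHom (coefVector B)) hcon
  have hcoef : ∀ S, coefVector B S =
      ∑ C ∈ (minBalancedSystems N).erase B, c C * coefVector C S := fun S => by
    have h := hsum (Pi.single S 1)
    simpa only [pairingHom_apply, pairing_single] using h
  have hmb : ∀ C ∈ (minBalancedSystems N).erase B, IsMinBalanced C ∧ 2 ≤ C.card := fun C hC =>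
    mem_minBalancedSystems.1 (Finset.mem_of_mem_erase hC)
  set P := ((minBalancedSystems N).erase B).filter fun C => 0 < c C with hP
  have hPne : P.Nonempty := by
    by_contra hne
    rw [Finset.not_nonempty_iff_eq_empty] at hne
    have h1 := hcoef (carrier B)
    rw [coefVector_carrier, Finset.sum_eq_zero] at h1
    · exact hmin.normalizer_pos.ne' h1
    · intro C hC
      have : ¬ 0 < c C := fun h => Finset.notMem_empty C (hne ▸ Finset.mem_filter.2 ⟨hC, h⟩)
      rw [le_antisymm (not_lt.1 this) (hc C), zero_mul]
  -- Members of `C₀` are smaller than every carrier in `P`, so at them no vector that is used has a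
  -- positive coefficient.
  obtain ⟨C₀, hC₀, hle⟩ := P.exists_min_image (fun C => (carrier C).card) hPne
  obtain ⟨hC₀e, hcC₀⟩ := Finset.mem_filter.1 hC₀
  obtain ⟨hm₀, h2₀⟩ := hmb C₀ hC₀e
  have hsub : C₀ ⊆ B := by
    intro S hS
    have hS0 : S ≠ ∅ := fun h => hm₀.empty_notMem (h ▸ hS)
    rw [← hmin.coefVector_neg_iff h2 hS0, hcoef S]
    refine Finset.sum_neg' (fun C hC => ?_)
      ⟨C₀, hC₀e, mul_neg_of_pos_of_neg hcC₀ ((hm₀.coefVector_neg_iff h2₀ hS0).2 hS)⟩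
    rcases (hc C).lt_or_eq with h0 | h0
    · refine mul_nonpos_of_nonneg_of_nonpos h0.le
        (coefVector_nonpos_of_ne (hmb C hC).1 hS0 fun h => ?_)
      have h3 := hle C (Finset.mem_filter.2 ⟨hC, h0⟩)
      have h4 := Finset.card_lt_card (hm₀.ssubset_carrier h2₀ hS)
      rw [h] at h4
      omega
    · rw [← h0, zero_mul]
  have hcar : carrier C₀ ⊆ carrier B := Finset.biUnion_subset_biUnion_of_subset_left _ hsub
  by_cases heq : carrier C₀ = carrier B
  · have h := hm₀.2.1
    simp only [heq] at h
    exact (Finset.ne_of_mem_erase hC₀e) (Finset.Subset.antisymm hsub (hmin.2.2 h hsub))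
  · refine hirr (hmin.isReducible (Finset.ssubset_iff_subset_ne.2 ⟨hcar, heq⟩)
      hm₀.carrier_nonempty ?_)
    obtain ⟨w, hw⟩ := hm₀.exists_conicWeights
    exact mem_incidenceCone_iff.2 ⟨w, hw.mono fun S hS =>
      Finset.mem_filter.2 ⟨hsub hS, hm₀.ssubset_carrier h2₀ hS⟩⟩

/-- Moving the separating point towards the interior point `|S|²` reaches the hyperplane of `B` with
all other inequalities strict. Near that point the face fills the hyperplane. -/
theorem isFacetDefining_of_irreducible {B : Finset (Finset N)} (hB : B ∈ irreducibleSystems N) :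
    IsFacetDefining (extendedCone N) (coefVector B) 0 := by
  obtain ⟨m, hm, hmB⟩ := exists_separating_of_irreducible hB
  obtain ⟨hmin, h2, -⟩ := hB
  set p : Finset N → ℝ := fun S => (S.card : ℝ) ^ 2 with hp
  have hppos : ∀ C ∈ minBalancedSystems N, 0 < pairing (coefVector C) p := fun C hC =>
    (mem_minBalancedSystems.1 hC).1.pairing_card_sq_pos (mem_minBalancedSystems.1 hC).2
  have hpB := hppos B (mem_minBalancedSystems.2 ⟨hmin, h2⟩)
  set s : ℝ := -pairing (coefVector B) m / pairing (coefVector B) p with hs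
  have hs0 : 0 < s := div_pos (neg_pos.2 hmB) hpB
  have hqB : pairing (coefVector B) (m + s • p) = 0 := by
    rw [pairing_add_right, pairing_smul_right, hs, div_mul_cancel₀ _ hpB.ne']
    ring
  have hq : ∀ C ∈ (minBalancedSystems N).erase B, 0 < pairing (coefVector C) (m + s • p) := by
    intro C hC
    rw [pairing_add_right, pairing_smul_right]
    exact add_pos_of_nonneg_of_pos (hm C hC)
      (mul_pos hs0 (hppos C (Finset.mem_of_mem_erase hC)))
  have hface : ∀ x, pairing (coefVector B) x = 0 →
      (∀ C ∈ (minBalancedSystems N).erase B, 0 < pairing (coefVector C) x) →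
      x ∈ face (extendedCone N) (coefVector B) 0 := by
    refine fun x hx hxC => ⟨mem_extendedCone_iff_forall_mem.2 fun C hC => ?_, hx⟩
    by_cases hCB : C = B
    · rw [hCB, hx]
    · exact (hxC C (Finset.mem_erase.2 ⟨hCB, hC⟩)).le
  refine isFacetDefining_of_ker_le hmin.coefVector_ne_zero
    (fun x hx => mem_extendedCone_iff.1 hx B hmin h2) fun v hv => ?_
  obtain ⟨ε, hε, hεC⟩ := exists_perturbation ((minBalancedSystems N).erase B) coefVector hq v
  refine mem_vectorSpan_of_add_smul hε (hface _ hqB hq) (hface _ ?_ hεC)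
  rw [LinearMap.mem_ker, pairingHom_apply] at hv
  rw [pairing_add_right, hqB, pairing_smul_right, hv, mul_zero, add_zero]

/-- The inequality of a reducible system is the sum of two valid inequalities, one of which is not
proportional to it. -/
theorem IsMinBalanced.not_isReducible {B : Finset (Finset N)} (hB : IsMinBalanced B)
    (h2 : 2 ≤ B.card) (h : IsFacetDefining (extendedCone N) (coefVector B) 0) :
    ¬ IsReducible B := by
  rintro ⟨A, hA, D, hD, hcone, -⟩
  obtain ⟨μ, hμ⟩ := mem_incidenceCone_iff.1 hcone
  have hA0 : A.Nonempty := by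
    rw [Finset.nonempty_iff_ne_empty]
    rintro rfl
    exact Finset.not_ssubset_empty D (Finset.mem_filter.1 hD).2
  obtain ⟨t, ht, E, -, hw⟩ := hB.exists_exchange hA0 hμ
  have hvanish : ∀ m ∈ face (extendedCone N) (coefVector B) 0,
      pairing (excessVector A μ) m = 0 := by
    rintro m ⟨hm, hm0⟩
    rw [pairing_coefVector hB h2, mul_eq_zero, or_iff_right hB.normalizer_pos.ne'] at hm0
    have h1 := excess_nonneg hm hw
    have h3 := excess_nonneg hm hμ
    have hsplit : excess (carrier B) (balancingWeights B) m =
        excess (carrier B) (fun S => balancingWeights B S - t * μ S + if S = A then t else 0) m +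
          t * excess A μ m := by
      simp only [excess, add_mul, sub_mul, Finset.sum_add_distrib, Finset.sum_sub_distrib,
        mul_assoc, ← Finset.mul_sum, ite_mul, zero_mul, Finset.sum_ite_eq', Finset.mem_univ,
        if_true]
      ring
    rw [pairing_excessVector]
    rw [hm0] at hsplit
    have h4 := mul_nonneg ht.le h3
    have h5 : t * excess A μ m = 0 := by linarith
    exact (mul_eq_zero.1 h5).resolve_left ht.ne'
  obtain ⟨c, hc⟩ := h.exists_eq_smul hvanish
  -- Non-proportionality: the vector for `A` vanishes at the carrier, where `coefVector B` does not,
  -- yet equals 1 at `A`.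
  have hM : excessVector A μ (carrier B) = 0 := by
    have : μ (carrier B) = 0 := hμ.eq_zero _ fun h =>
      hB.carrier_notMem h2 (Finset.mem_filter.1 h).1
    simp [excessVector, this, hA.ne', hB.carrier_nonempty.ne_empty]
  have hAA : excessVector A μ A = 1 := by
    have : μ A = 0 := hμ.eq_zero _ fun h => (Finset.mem_filter.1 h).2.2 subset_rfl
    simp [excessVector, this, hA0.ne_empty]
  rw [hc, Pi.smul_apply, smul_eq_mul, coefVector_carrier, mul_eq_zero,
    or_iff_left hB.normalizer_pos.ne'] at hM
  rw [hc, hM, zero_smul] at hAA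
  exact zero_ne_one hAA

/-- The sign of the factor is read off at `|S|²`, where the pairing with `coefVector B` is strictly
positive. -/
theorem pos_of_eq_smul {B : Finset (Finset N)} (hB : IsMinBalanced B) (h2 : 2 ≤ B.card)
    {α : Finset N → ℝ} {c : ℝ} (hα : ∀ m ∈ extendedCone N, 0 ≤ pairing α m)
    (h : coefVector B = c • α) : 0 < c := by
  have h1 := hB.pairing_card_sq_pos h2
  rw [h, pairing_smul] at h1
  exact pos_of_mul_pos_left h1 (hα _ card_sq_mem_extendedCone)

/-- Farkas writes `α` as a conic combination of coefficient vectors; each one actually used vanishes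
on the facet and is therefore proportional to `α`. -/
theorem IsFacetDefining.exists_minBalanced {α : Finset N → ℝ}
    (h : IsFacetDefining (extendedCone N) α 0) :
    ∃ B : Finset (Finset N), IsMinBalanced B ∧ 2 ≤ B.card ∧
      ∃ c : ℝ, 0 < c ∧ α = c • coefVector B := by
  obtain ⟨b, hb, hsum⟩ := exists_nonneg_combination_of_forall_nonneg
    (minBalancedSystems N) (fun C => pairingHom (coefVector C)) (pairingHom α)
    (fun x hx => h.1 x (mem_extendedCone_iff_forall_mem.2 hx))
  simp only [pairingHom_apply] at hsum
  obtain ⟨B, hB, hbB⟩ : ∃ B ∈ minBalancedSystems N, 0 < b B := by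
    by_contra hcon
    push Not at hcon
    refine h.ne_zero (funext fun S => ?_)
    rw [← pairing_single α S, hsum, Finset.sum_eq_zero]
    · rfl
    · intro C hC
      rw [le_antisymm (hcon C hC) (hb C), zero_mul]
  obtain ⟨hmin, h2⟩ := mem_minBalancedSystems.1 hB
  obtain ⟨c, hc⟩ := h.exists_eq_smul (β := coefVector B) (by
    rintro m ⟨hm, hm0⟩
    rw [hsum, Finset.sum_eq_zero_iff_of_nonneg fun C hC =>
      mul_nonneg (hb C) (mem_extendedCone_iff_forall_mem.1 hm C hC)] at hm0
    exact (mul_eq_zero.1 (hm0 B hB)).resolve_left hbB.ne')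
  have hc0 := pos_of_eq_smul hmin h2 h.1 hc
  exact ⟨B, hmin, h2, c⁻¹, inv_pos.2 hc0, by
    rw [hc, smul_smul, inv_mul_cancel₀ hc0.ne', one_smul]⟩

theorem isFacetDefining_iff {α : Finset N → ℝ} {k : ℝ} :
    IsFacetDefining (extendedCone N) α k ↔
      k = 0 ∧ ∃ B ∈ irreducibleSystems N, ∃ c : ℝ, 0 < c ∧ α = c • coefVector B := by
  constructor
  · intro h
    obtain rfl := h.eq_zero
    obtain ⟨B, hB, h2, c, hc, rfl⟩ := h.exists_minBalanced
    have h' := h.smul (inv_pos.2 hc)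
    rw [smul_smul, inv_mul_cancel₀ hc.ne', one_smul] at h'
    exact ⟨rfl, B, ⟨hB, h2, hB.not_isReducible h2 h'⟩, c, hc, rfl⟩
  · rintro ⟨rfl, B, hB, c, hc, rfl⟩
    exact (isFacetDefining_of_irreducible hB).smul hc

/-- Equal facets force positively proportional vectors, which have the same negative coordinates off
`∅`. -/
theorem face_coefVector_injOn :
    Set.InjOn (fun B => face (extendedCone N) (coefVector B) 0) (irreducibleSystems N) := by
  intro B hB B' hB' heq
  have h := isFacetDefining_of_irreducible hB
  obtain ⟨c, hc⟩ := h.exists_eq_smul (β := coefVector B') fun m hm => by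
    have hm' : m ∈ face (extendedCone N) (coefVector B') 0 := by
      simp only at heq
      rwa [← heq]
    exact hm'.2
  have hc0 := pos_of_eq_smul hB'.1 hB'.2.1 h.1 hc
  ext S
  by_cases hS : S = ∅
  · subst hS
    exact iff_of_false hB.1.empty_notMem hB'.1.empty_notMem
  · rw [← hB.1.coefVector_neg_iff hB.2.1 hS, ← hB'.1.coefVector_neg_iff hB'.2.1 hS, hc,
      Pi.smul_apply, smul_eq_mul, mul_neg_iff]
    exact ⟨fun h => Or.inl ⟨hc0, h⟩, fun h => (h.resolve_right fun h' => hc0.not_gt h'.1).2⟩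

theorem face_coefVector_bijOn :
    Set.BijOn (fun B => face (extendedCone N) (coefVector B) 0) (irreducibleSystems N)
      (facets (extendedCone N)) := by
  refine ⟨fun B hB => ⟨_, _, isFacetDefining_of_irreducible hB, rfl⟩, face_coefVector_injOn, ?_⟩
  rintro F ⟨α, k, h, rfl⟩
  obtain ⟨rfl, B, hB, c, hc, rfl⟩ := isFacetDefining_iff.1 h
  exact ⟨B, hB, (face_smul hc _ _).symm⟩

end FacetLemmas

end TotallyBalanced

theorem theorem1 (N : Type*) [Fintype N] [DecidableEq N] (hN : 2 ≤ Fintype.card N) :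
    (∀ (α : Finset N → ℝ) (k : ℝ),
      TotallyBalanced.IsFacetDefining (TotallyBalanced.extendedCone N) α k ↔
        k = 0 ∧ ∃ B ∈ TotallyBalanced.irreducibleSystems N, ∃ c : ℝ,
          0 < c ∧ α = c • TotallyBalanced.coefVector B) ∧
    Set.BijOn
      (fun B => TotallyBalanced.face (TotallyBalanced.extendedCone N)
        (TotallyBalanced.coefVector B) 0)
      (TotallyBalanced.irreducibleSystems N)
      (TotallyBalanced.facets (TotallyBalanced.extendedCone N)) := by
  exact ⟨fun _ _ => TotallyBalanced.isFacetDefining_iff,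
    TotallyBalanced.face_coefVector_bijOn⟩
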